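/- Let $K$ be a compact topological group, let $V$ be a finite-dimensional real vector space with its usual topology, and let $\tau$ be a continuous linear representation of $K$ on $V$, i.e. a homomorphism $\tau : K \to GL(V)$ such that the map $K \times V \to V$, $(k,v) \mapsto \tau(k)v$, is continuous. Let $G = K \ltimes_\tau V$ be the semidirect product: the set $K \times V$ with the product topology and the multiplication $(k,v)(l,w) = (kl,\, v + \tau(k)w)$. Identify each $v \in V$ with the element $(e,v)$ of $G$. Then for every discrete subgroup $\Gamma$ of $G$ there is a real linear subspace $W \subset V$ such that $\Gamma$ and $W$ are strongly similar in $G$, that is, there exist an element $g \in G$ and a compact subset $S \subset G$ with $$\Gamma \subset g W S \quad\text{and}\quad W \subset g\, \Gamma S.$$ -/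

import Mathlib

open scoped Pointwise

/-- Two subsets `L`, `H` of a topological group are (right) strongly similar if there are one
element `g` and one compact set `S` with `L ⊆ g H S` and `H ⊆ g L S`. -/
def StronglySimilar {G : Type*} [Group G] [TopologicalSpace G] (L H : Set G) : Prop :=
  ∃ (g : G) (S : Set G), IsCompact S ∧ L ⊆ {g} * H * S ∧ H ⊆ {g} * L * S

/-- The product topology on a semidirect product. -/
instance SemidirectProduct.instTopologicalSpaceProd {N G : Type*} [Group N] [Group G]
    [TopologicalSpace N] [TopologicalSpace G] (φ : G →* MulAut N) :
    TopologicalSpace (N ⋊[φ] G) :=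
  TopologicalSpace.induced (fun x => (x.left, x.right)) inferInstance

/-- A linear representation of a group `K` on `V`, as an action of `K` on the additive group of `V`
(written multiplicatively) by group automorphisms. -/
def Representation.toMulAutMultiplicative {K V : Type*} [Group K] [AddCommGroup V] [Module ℝ V]
    (τ : Representation ℝ K V) : K →* MulAut (Multiplicative V) where
  toFun k :=
    { toFun := fun x => Multiplicative.ofAdd (τ k x.toAdd)
      invFun := fun x => Multiplicative.ofAdd (τ k⁻¹ x.toAdd)
      left_inv := fun x => by simp
      right_inv := fun x => by simp
      map_mul' := fun x y => by simp }
  map_one' := by ext x; simp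
  map_mul' k l := by ext x; simp

/-- The group `K ⋉_τ V`. Its elements are pairs of a vector and an element of `K`, the product is
`(v, k) (w, l) = (v + τ k w, k l)`, and the topology is that of `V × K`. -/
abbrev Representation.SemidirectGroup {K V : Type*} [Group K] [AddCommGroup V] [Module ℝ V]
    (τ : Representation ℝ K V) : Type _ :=
  Multiplicative V ⋊[τ.toMulAutMultiplicative] K

/-- A vector `v`, regarded as the element `(v, 1)` of `K ⋉_τ V`. -/
def Representation.translation {K V : Type*} [Group K] [AddCommGroup V] [Module ℝ V]
    (τ : Representation ℝ K V) (v : V) : τ.SemidirectGroup :=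
  SemidirectProduct.inl (Multiplicative.ofAdd v)

/-- If `K` is a topological group and the action map is continuous, then `K ⋉_τ V` is a topological
group. -/
theorem Representation.isTopologicalGroup_semidirectGroup {K V : Type*}
    [Group K] [TopologicalSpace K] [IsTopologicalGroup K]
    [NormedAddCommGroup V] [NormedSpace ℝ V] (τ : Representation ℝ K V)
    (hτ : Continuous fun p : K × V => τ p.1 p.2) : IsTopologicalGroup τ.SemidirectGroup := by
  have hi : Topology.IsInducing
      (fun x : τ.SemidirectGroup => ((x.left, x.right) : Multiplicative V × K)) := ⟨rfl⟩
  have hl : Continuous fun x : τ.SemidirectGroup => (x.left.toAdd : V) :=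
    continuous_toAdd.comp (continuous_fst.comp hi.continuous)
  have hr : Continuous fun x : τ.SemidirectGroup => x.right := continuous_snd.comp hi.continuous
  refine { continuous_mul := ?_, continuous_inv := ?_ }
  · rw [hi.continuous_iff]
    refine Continuous.prodMk ?_ ?_
    · exact continuous_ofAdd.comp ((hl.comp continuous_fst).add
        (hτ.comp ((hr.comp continuous_fst).prodMk (hl.comp continuous_snd))))
    · exact (hr.comp continuous_fst).mul (hr.comp continuous_snd)
  · rw [hi.continuous_iff]
    refine Continuous.prodMk ?_ ?_
    · exact continuous_ofAdd.comp (hτ.comp (hr.inv.prodMk hl.neg))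
    · exact hr.inv

open scoped commutatorElement

/-! `Γ` acts on `V` by affine maps `v ↦ a g + T g v`, where `‖T g‖ ≤ M` by compactness of `K` and
only finitely many `a g` lie in any ball by discreteness. The argument is of Bieberbach–Zassenhaus
type, with power boundedness in place of an invariant inner product. If `T g` and `T h` are close to
`1`, the iterated commutators `⁅g, ⁅g, …, h⁆⁆` contract, so discreteness makes them trivial at some
stage. Descending from there, `g` and `h` commute as affine maps (`commute_of_small`). The small
elements generate a subgroup, commuting as affine maps, that has finitely many cosets up to bounded
error (`exists_submodule_of_discrete`). For commuting affine maps, an operator `S` into the common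
fixed vectors makes `S ∘ a` a homomorphism at bounded distance from `a`, and its image is coarsely
dense in its span `W` (`exists_submodule_of_pairwise_commute`). -/

/-! ### Small powers and power bounded operators. -/

/-- A normed algebra has no small subgroups: an element all of whose powers stay uniformly within
distance less than `1` of `1` is trivial. -/
theorem eq_one_of_norm_pow_sub_one_le {R : Type*} [NormedRing R] [NormedAlgebra ℝ R] {c : R}
    {r : ℝ} (hr : r < 1) (h : ∀ n : ℕ, ‖c ^ n - 1‖ ≤ r) : c = 1 := by
  -- Squaring moves `d` away from `1` by a factor of at least `2 - r > 1`.
  have step (d : R) (hd : ‖d - 1‖ ≤ r) : (2 - r) * ‖d - 1‖ ≤ ‖d ^ 2 - 1‖ := by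
    have e : (2 : ℝ) • (d - 1) = (d ^ 2 - 1) - (d - 1) * (d - 1) := by
      rw [two_smul]; noncomm_ring
    have h1 : ‖(2 : ℝ) • (d - 1)‖ ≤ ‖d ^ 2 - 1‖ + ‖d - 1‖ * ‖d - 1‖ := by
      rw [e]; exact (norm_sub_le _ _).trans (by gcongr; exact norm_mul_le _ _)
    rw [norm_smul, Real.norm_ofNat] at h1
    nlinarith [norm_nonneg (d - 1)]
  have grow (k : ℕ) : (2 - r) ^ k * ‖c - 1‖ ≤ ‖c ^ 2 ^ k - 1‖ := by
    induction k with
    | zero => simp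
    | succ k ih =>
      have := step _ (h (2 ^ k))
      rw [← pow_mul, ← pow_succ] at this
      calc (2 - r) ^ (k + 1) * ‖c - 1‖ = (2 - r) * ((2 - r) ^ k * ‖c - 1‖) := by ring
        _ ≤ (2 - r) * ‖c ^ 2 ^ k - 1‖ := by gcongr; linarith
        _ ≤ _ := this
  by_contra hc
  have hpos : 0 < ‖c - 1‖ := norm_pos_iff.2 (sub_ne_zero.2 hc)
  obtain ⟨k, hk⟩ := pow_unbounded_of_one_lt (r / ‖c - 1‖) (show 1 < 2 - r by linarith)
  rw [div_lt_iff₀ hpos] at hk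
  linarith [grow k, h (2 ^ k)]

theorem eq_zero_of_forall_natCast_mul_norm_le {V : Type*} [NormedAddCommGroup V] {x : V} {C : ℝ}
    (h : ∀ n : ℕ, n * ‖x‖ ≤ C) : x = 0 := by
  by_contra hx
  have hpos : 0 < ‖x‖ := norm_pos_iff.2 hx
  obtain ⟨n, hn⟩ := exists_nat_gt (C / ‖x‖)
  rw [div_lt_iff₀ hpos] at hn
  linarith [h n]

section PowerBounded

variable {V : Type*} [NormedAddCommGroup V] [NormedSpace ℝ V] {A : V →L[ℝ] V} {M : ℝ}

/-- The vectors `A ^ n y = y + n (A - 1) y` stay bounded only if the linear term vanishes: there is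
no nontrivial Jordan block at `1`. -/
theorem sub_one_apply_eq_zero_of_sq (hA : ∀ n : ℕ, ‖A ^ n‖ ≤ M) {y : V}
    (h : (A - 1) ((A - 1) y) = 0) : (A - 1) y = 0 := by
  have e (n : ℕ) : (A ^ n) y = y + (n : ℝ) • (A - 1) y := by
    induction n with
    | zero => simp
    | succ n ih =>
      have h' : A ((A - 1) y) = (A - 1) y := by
        rw [← sub_eq_zero]; simpa using h
      rw [pow_succ', mul_apply_eq_comp, ih, map_add, map_smul, h']
      have : A y = y + (A - 1) y := by simp
      rw [this]; push_cast; module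
  refine eq_zero_of_forall_natCast_mul_norm_le (C := M * ‖y‖ + ‖y‖) fun n => ?_
  have : (n : ℝ) • (A - 1) y = (A ^ n) y - y := by rw [e]; abel
  calc (n : ℝ) * ‖(A - 1) y‖ = ‖(A ^ n) y - y‖ := by rw [← this, norm_smul]; simp
    _ ≤ ‖(A ^ n) y‖ + ‖y‖ := norm_sub_le _ _
    _ ≤ _ := by gcongr; exact (A ^ n).le_of_opNorm_le (hA n) y

theorem sub_one_apply_eq_zero_of_pow (hA : ∀ n : ℕ, ‖A ^ n‖ ≤ M) {y : V} {k : ℕ}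
    (h : ((A - 1) ^ k) y = 0) : (A - 1) y = 0 := by
  induction k generalizing y with
  | zero => simp only [pow_zero, one_apply_eq_self] at h; simp [h]
  | succ k ih =>
    rw [pow_succ, mul_apply_eq_comp] at h
    exact sub_one_apply_eq_zero_of_sq hA (ih h)

/-- The projection onto the fixed vectors of a power bounded operator. -/
theorem exists_fixed_projection [FiniteDimensional ℝ V] (hA : ∀ n : ℕ, ‖A ^ n‖ ≤ M) :
    ∃ P R : V →L[ℝ] V, P * (A - 1) = 0 ∧ P = 1 + R * (A - 1) ∧
      ∀ B, Commute A B → Commute P B := by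
  -- Write the minimal polynomial as `(X - 1) ^ e * q` with `q(1) ≠ 0`. Power boundedness lowers `e`
  -- to `1` in the relation, and `P = q(A) / q(1)`.
  obtain ⟨q, hq, hdvd⟩ := (minpoly ℝ A).exists_eq_pow_rootMultiplicity_mul_and_not_dvd
    (minpoly.ne_zero (Algebra.IsIntegral.isIntegral A)) 1
  have hq1 : q.eval 1 ≠ 0 := fun h => hdvd (Polynomial.dvd_iff_isRoot.2 h)
  set e := (minpoly ℝ A).rootMultiplicity 1
  have hz : (A - 1) ^ e * Polynomial.aeval A q = 0 := by
    have := minpoly.aeval ℝ A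
    rw [hq] at this
    simpa using this
  have hkill : (A - 1) * Polynomial.aeval A q = 0 := by
    ext v
    exact sub_one_apply_eq_zero_of_pow hA (k := e) (DFunLike.congr_fun hz v)
  obtain ⟨r, hr⟩ : (Polynomial.X - Polynomial.C 1) ∣ q - Polynomial.C (q.eval 1) := by
    rw [Polynomial.dvd_iff_isRoot]; simp
  have hc : Commute (A - 1) (Polynomial.aeval A q) := by
    have := (Commute.all (Polynomial.X - Polynomial.C 1) q).map (Polynomial.aeval A)
    simpa using this
  have hqr : Polynomial.aeval A q = (q.eval 1) • (1 : V →L[ℝ] V)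
      + Polynomial.aeval A r * (A - 1) := by
    have := congrArg (Polynomial.aeval A) hr
    rw [mul_comm] at this
    simp only [map_sub, map_mul, Polynomial.aeval_C, Polynomial.aeval_X, map_one,
      Algebra.algebraMap_eq_smul_one] at this
    rw [← this]; abel
  refine ⟨(q.eval 1)⁻¹ • Polynomial.aeval A q, (q.eval 1)⁻¹ • Polynomial.aeval A r, ?_, ?_, ?_⟩
  · rw [smul_mul_assoc, ← hc.eq, hkill, smul_zero]
  · rw [hqr, smul_add, smul_smul, inv_mul_cancel₀ hq1, one_smul, smul_mul_assoc]
  · intro B hB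
    refine Commute.smul_left ?_ _
    refine Polynomial.induction_on q (fun a => ?_) (fun p q hp hq => ?_) (fun n a _ => ?_)
    · rw [Polynomial.aeval_C]; exact Algebra.commutes a B
    · simpa using hp.add_left hq
    · rw [map_mul, Polynomial.aeval_C, map_pow, Polynomial.aeval_X]
      exact Commute.mul_left (Algebra.commutes a B) (hB.pow_left (n + 1))

/-- For commuting power bounded operators, a vector in `range (A - 1) + range (B - 1)` that is
fixed by `A` and `B` vanishes. -/
theorem sub_one_apply_eq_of_fixed [FiniteDimensional ℝ V] {B : V →L[ℝ] V}
    (hA : ∀ n : ℕ, ‖A ^ n‖ ≤ M) (hB : ∀ n : ℕ, ‖B ^ n‖ ≤ M) (hAB : Commute A B) {a b : V}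
    (h1 : (A - 1) ((A - 1) b - (B - 1) a) = 0) (h2 : (B - 1) ((B - 1) a - (A - 1) b) = 0) :
    (A - 1) b = (B - 1) a := by
  obtain ⟨P, R, hP, hR, hc⟩ := exists_fixed_projection hA
  -- `P` fixes the difference and kills `(A - 1) b`, so the difference is `-(B - 1) (P a)`, which `B
  -- - 1` kills as well.
  have e1 : P ((A - 1) b - (B - 1) a) = (A - 1) b - (B - 1) a := by
    rw [hR, add_apply, mul_apply_eq_comp, h1]; simp
  have e2 : P ((A - 1) b) = 0 := DFunLike.congr_fun hP b
  have e3 : P ((B - 1) a) = (B - 1) (P a) := by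
    rw [← mul_apply_eq_comp, ← mul_apply_eq_comp,
      ((hc B hAB).sub_right (Commute.one_right P)).eq]
  rw [map_sub, e2, e3, zero_sub] at e1
  have e4 : (B - 1) (P a) = (B - 1) a - (A - 1) b := by
    have := congrArg Neg.neg e1
    rwa [neg_neg, neg_sub] at this
  rw [← e4] at h2
  rw [sub_one_apply_eq_zero_of_sq hB h2] at e4
  exact (sub_eq_zero.1 e4.symm).symm

end PowerBounded

/-! ### Commutators in a discrete group of affine maps. -/

section Cocycle

variable {Γ V : Type*} [Group Γ] [NormedAddCommGroup V] [NormedSpace ℝ V]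
  {T : Γ →* (V →L[ℝ] V)} {a : Γ → V} {M : ℝ}

theorem norm_map_commutator_sub_one_le (hM : ∀ g, ‖T g‖ ≤ M) (g h : Γ) :
    ‖T ⁅g, h⁆ - 1‖ ≤ 2 * M ^ 2 * (‖T g - 1‖ * ‖T h - 1‖) := by
  have hM0 : 0 ≤ M := (norm_nonneg _).trans (hM 1)
  have hinv : T h * T g * (T g⁻¹ * T h⁻¹) = 1 := by
    simp only [← map_mul]; simp
  have e : T ⁅g, h⁆ - 1 =
      ((T g - 1) * (T h - 1) - (T h - 1) * (T g - 1)) * (T g⁻¹ * T h⁻¹) := by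
    have e1 : T ⁅g, h⁆ = T g * T h * (T g⁻¹ * T h⁻¹) := by
      simp only [← map_mul, commutatorElement_def, mul_assoc]
    have e2 : (T g - 1) * (T h - 1) - (T h - 1) * (T g - 1) = T g * T h - T h * T g := by
      noncomm_ring
    rw [e2, sub_mul, hinv, e1]
  rw [e]
  calc _ ≤ ‖(T g - 1) * (T h - 1) - (T h - 1) * (T g - 1)‖ * ‖T g⁻¹ * T h⁻¹‖ := norm_mul_le _ _
    _ ≤ (‖T g - 1‖ * ‖T h - 1‖ + ‖T h - 1‖ * ‖T g - 1‖) * (M * M) := by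
      refine mul_le_mul ((norm_sub_le _ _).trans (add_le_add (norm_mul_le _ _) (norm_mul_le _ _)))
        ((norm_mul_le _ _).trans ?_) (norm_nonneg _) (by positivity)
      exact mul_le_mul (hM _) (hM _) (norm_nonneg _) hM0
    _ = _ := by ring

/-- Obtained by expanding `a` on `⁅g, h⁆ * (h * g) = g * h`. In this form every term carries a
factor `T _ - 1`, which is what makes iterated commutators contract. -/
theorem cocycle_commutator (ha : ∀ g h, a (g * h) = a g + T g (a h)) (g h : Γ) :
    a ⁅g, h⁆ = (T g - 1) (a h) - (T ⁅g, h⁆ - 1) (a h) - (T h - 1) (a g)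
      - (T ⁅g, h⁆ - 1) (T h (a g)) := by
  have e : a (⁅g, h⁆ * (h * g)) = a (g * h) := by
    congr 1; simp [commutatorElement_def, mul_assoc]
  rw [ha, ha, ha] at e
  rw [← sub_eq_iff_eq_add.2 e.symm]
  simp only [sub_apply, one_apply_eq_self, map_add]
  abel

/-- If `T h` is close to `1` and `T g` commutes with `T ⁅g, h⁆`, then `T g` commutes with `T h`. -/
theorem map_commutator_eq_one_of_commutator (hM : ∀ g, ‖T g‖ ≤ M) (hM1 : 1 ≤ M) {g h : Γ}
    (hh : 8 * M ^ 3 * ‖T h - 1‖ ≤ 1) (hc : T ⁅g, ⁅g, h⁆⁆ = 1) : T ⁅g, h⁆ = 1 := by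
  have hM0 : 0 ≤ M := zero_le_one.trans hM1
  have hcomm : Commute (T g) (T ⁅g, h⁆) := by
    have e : ⁅g, ⁅g, h⁆⁆ * (⁅g, h⁆ * g) = g * ⁅g, h⁆ := by
      simp only [commutatorElement_def g ⁅g, h⁆]; group
    have := congrArg T e
    rw [map_mul, hc, one_mul, map_mul, map_mul] at this
    exact this.symm
  have hconj : T g * T h * T g⁻¹ = T ⁅g, h⁆ * T h := by
    simp only [← map_mul, commutatorElement_def]; congr 1; group
  -- Conjugates of `T h` by powers of `g` stay close to `1`, hence so do all powers of `T ⁅g, h⁆`.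
  have hpow (n : ℕ) : T (g ^ n) * T h * T (g ^ n)⁻¹ = T ⁅g, h⁆ ^ n * T h := by
    induction n with
    | zero => simp
    | succ n ih =>
      have e : T (g ^ (n + 1)) * T h * T (g ^ (n + 1))⁻¹
          = T g * (T (g ^ n) * T h * T (g ^ n)⁻¹) * T g⁻¹ := by
        simp only [← map_mul]; congr 1; group
      rw [e, ih, ← mul_assoc, (hcomm.pow_right n).eq, mul_assoc, mul_assoc, ← mul_assoc (T g),
        hconj, ← mul_assoc, ← pow_succ]
  refine eq_one_of_norm_pow_sub_one_le (r := 1 / 4) (by norm_num) fun n => ?_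
  have hh1 : T h * T h⁻¹ = 1 := by rw [← map_mul]; simp
  have hg1 : T (g ^ n) * T (g ^ n)⁻¹ = 1 := by rw [← map_mul]; simp
  have e : T ⁅g, h⁆ ^ n - 1 = (T (g ^ n) * (T h - 1) * T (g ^ n)⁻¹ - (T h - 1)) * T h⁻¹ := by
    have e1 : T (g ^ n) * (T h - 1) * T (g ^ n)⁻¹ = T ⁅g, h⁆ ^ n * T h - 1 := by
      rw [mul_sub, mul_one, sub_mul, hpow, hg1]
    rw [e1, sub_sub_sub_cancel_right, sub_mul, mul_assoc, hh1, mul_one]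
  rw [e]
  calc _ ≤ (‖T (g ^ n)‖ * ‖T h - 1‖ * ‖T (g ^ n)⁻¹‖ + ‖T h - 1‖) * ‖T h⁻¹‖ := by
        refine (norm_mul_le _ _).trans (mul_le_mul_of_nonneg_right ?_ (norm_nonneg _))
        exact (norm_sub_le _ _).trans (by gcongr; exact norm_mul₃_le)
    _ ≤ (M * ‖T h - 1‖ * M + ‖T h - 1‖) * M := by gcongr <;> exact hM _
    _ ≤ 2 * M ^ 3 * ‖T h - 1‖ := by
      have : M ≤ M ^ 3 := le_self_pow₀ hM1 (by norm_num)
      nlinarith [norm_nonneg (T h - 1)]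
    _ ≤ 1 / 4 := by linarith

theorem eight_mul_le_one_of_small (hM1 : 1 ≤ M) {x : ℝ} (hx0 : 0 ≤ x) (hx : 8 * M ^ 3 * x ≤ 1) :
    x ≤ 1 / 8 ∧ M ^ 3 * x ≤ 1 / 8 := by
  have h1 : 1 ≤ M ^ 3 := one_le_pow₀ hM1
  constructor <;> nlinarith

/-- Iterated commutators with an element of small linear part contract to the identity. -/
theorem iterate_commutator_bound (ha : ∀ g h, a (g * h) = a g + T g (a h))
    (hM : ∀ g, ‖T g‖ ≤ M) (hM1 : 1 ≤ M) {g h : Γ}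
    (hg : 8 * M ^ 3 * ‖T g - 1‖ ≤ 1) (hh : 8 * M ^ 3 * ‖T h - 1‖ ≤ 1) (k : ℕ) :
    ‖T ((fun x => ⁅g, x⁆)^[k] h) - 1‖ ≤ (1 / 4) ^ k * ‖T h - 1‖ ∧
      ‖a ((fun x => ⁅g, x⁆)^[k] h)‖ ≤ (1 / 2) ^ k * (‖a g‖ + ‖a h‖) := by
  have hM0 : 0 ≤ M := zero_le_one.trans hM1
  obtain ⟨hp, hp3⟩ := eight_mul_le_one_of_small hM1 (norm_nonneg _) hg
  obtain ⟨hq, -⟩ := eight_mul_le_one_of_small hM1 (norm_nonneg _) hh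
  induction k with
  | zero => simp
  | succ k ih =>
    obtain ⟨ih1, ih2⟩ := ih
    rw [Function.iterate_succ_apply']
    set x := (fun x => ⁅g, x⁆)^[k] h
    have hs := norm_map_commutator_sub_one_le hM g x
    set s := ‖T ⁅g, x⁆ - 1‖
    have hx0 := norm_nonneg (T x - 1)
    -- The threshold `8 * M ^ 3` is chosen so that `2 * M ^ 3 * ‖T g - 1‖ ≤ 1 / 4`. The linear parts
    -- then decay like `4 ^ (-k)`, fast enough to drive the translation parts down like `2 ^ (-k)`.
    have hs2 : s * M ≤ 1 / 4 * ‖T x - 1‖ :=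
      (mul_le_mul_of_nonneg_right hs hM0).trans (by nlinarith)
    have hs1 : s ≤ 1 / 4 * ‖T x - 1‖ :=
      (le_mul_of_one_le_right (norm_nonneg _) hM1).trans hs2
    have hx4 : ‖T x - 1‖ ≤ (1 / 4) ^ k * (1 / 8) := ih1.trans (by gcongr)
    have hk4 : (1 / 4 : ℝ) ^ k ≤ (1 / 2) ^ k := by gcongr; norm_num
    have hk1 : (1 / 2 : ℝ) ^ k ≤ 1 := pow_le_one₀ (by norm_num) (by norm_num)
    constructor
    · rw [pow_succ]; linarith
    · have h1 : ‖a ⁅g, x⁆‖ ≤ ‖T g - 1‖ * ‖a x‖ + s * ‖a x‖ + ‖T x - 1‖ * ‖a g‖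
          + s * (M * ‖a g‖) := by
        rw [cocycle_commutator ha]
        refine (norm_sub_le _ _).trans (add_le_add ((norm_sub_le _ _).trans (add_le_add
          ((norm_sub_le _ _).trans (add_le_add ?_ ?_)) ?_)) ?_)
        · exact (T g - 1).le_opNorm _
        · exact (T ⁅g, x⁆ - 1).le_opNorm _
        · exact (T x - 1).le_opNorm _
        · exact (T ⁅g, x⁆ - 1).le_opNorm_of_le ((T x).le_of_opNorm_le (hM x) _)
      have hag := norm_nonneg (a g)
      have hah := norm_nonneg (a h)
      have hax := norm_nonneg (a x)
      have h2 : ‖T g - 1‖ * ‖a x‖ ≤ 1 / 8 * ‖a x‖ := by gcongr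
      have h3 : s * ‖a x‖ ≤ 1 / 32 * ‖a x‖ := by gcongr; linarith
      have h4 : ‖T x - 1‖ * ‖a g‖ ≤ (1 / 2) ^ k * (1 / 8) * ‖a g‖ := by gcongr; linarith
      have h5 : s * (M * ‖a g‖) ≤ (1 / 2) ^ k * (1 / 32) * ‖a g‖ := by
        rw [← mul_assoc]; exact mul_le_mul_of_nonneg_right (by linarith) hag
      have h6 : 0 ≤ (1 / 2 : ℝ) ^ k * ‖a h‖ := by positivity
      have h7 : 0 ≤ (1 / 2 : ℝ) ^ k * ‖a g‖ := by positivity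
      rw [pow_succ]
      linarith

/-- The iterates stay in a finite set, on which `‖T x - 1‖ + ‖a x‖` takes finitely many values.
Since it tends to `0` along them, it equals `0` at some stage. -/
theorem exists_iterate_commutator_trivial (ha : ∀ g h, a (g * h) = a g + T g (a h))
    (hM : ∀ g, ‖T g‖ ≤ M) (hM1 : 1 ≤ M) (hfin : ∀ R : ℝ, {g | ‖a g‖ ≤ R}.Finite) {g h : Γ}
    (hg : 8 * M ^ 3 * ‖T g - 1‖ ≤ 1) (hh : 8 * M ^ 3 * ‖T h - 1‖ ≤ 1) :
    ∃ k, T ((fun x => ⁅g, x⁆)^[k] h) = 1 ∧ a ((fun x => ⁅g, x⁆)^[k] h) = 0 := by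
  have hb := iterate_commutator_bound ha hM hM1 hg hh
  set β : ℕ → Γ := fun k => (fun x => ⁅g, x⁆)^[k] h
  let u : Γ → ℝ := fun x => ‖T x - 1‖ + ‖a x‖
  have hlim : Filter.Tendsto (fun k => u (β k)) Filter.atTop (nhds 0) := by
    have l1 := (tendsto_pow_atTop_nhds_zero_of_lt_one (r := (1 / 4 : ℝ)) (by norm_num)
      (by norm_num)).mul_const ‖T h - 1‖
    have l2 := (tendsto_pow_atTop_nhds_zero_of_lt_one (r := (1 / 2 : ℝ)) (by norm_num)
      (by norm_num)).mul_const (‖a g‖ + ‖a h‖)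
    have l := l1.add l2
    rw [zero_mul, zero_mul, add_zero] at l
    exact squeeze_zero (fun k => by positivity) (fun k => add_le_add (hb k).1 (hb k).2) l
  have hF : ((u '' {g' | ‖a g'‖ ≤ ‖a g‖ + ‖a h‖}) \ {0}).Finite := ((hfin _).image u).sdiff
  obtain ⟨k, hk⟩ := (hlim.eventually
    (hF.isClosed.isOpen_compl.mem_nhds (by simp))).exists
  have hmem : β k ∈ {g' | ‖a g'‖ ≤ ‖a g‖ + ‖a h‖} :=
    (hb k).2.trans (mul_le_of_le_one_left (by positivity) (pow_le_one₀ (by norm_num) (by norm_num)))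
  have hu : u (β k) = 0 := by
    by_contra hne
    exact hk ⟨⟨_, hmem, rfl⟩, hne⟩
  have h1 := norm_nonneg (T (β k) - 1)
  have h2 := norm_nonneg (a (β k))
  have hu' : ‖T (β k) - 1‖ + ‖a (β k)‖ = 0 := hu
  exact ⟨k, sub_eq_zero.1 (norm_eq_zero.1 (by linarith)), norm_eq_zero.1 (by linarith)⟩

/-- Triviality of the linear part at a late stage is pulled back one commutator at a time by
`map_commutator_eq_one_of_commutator`. -/
theorem map_commutator_eq_one_of_small (ha : ∀ g h, a (g * h) = a g + T g (a h))
    (hM : ∀ g, ‖T g‖ ≤ M) (hM1 : 1 ≤ M) (hfin : ∀ R : ℝ, {g | ‖a g‖ ≤ R}.Finite) {g h : Γ}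
    (hg : 8 * M ^ 3 * ‖T g - 1‖ ≤ 1) (hh : 8 * M ^ 3 * ‖T h - 1‖ ≤ 1) : T ⁅g, h⁆ = 1 := by
  obtain ⟨k, hk, -⟩ := exists_iterate_commutator_trivial ha hM hM1 hfin hg hh
  have hsmall (j : ℕ) : 8 * M ^ 3 * ‖T ((fun x => ⁅g, x⁆)^[j] h) - 1‖ ≤ 1 := by
    refine le_trans ?_ hh
    have := (iterate_commutator_bound ha hM hM1 hg hh j).1
    have h1 : (1 / 4 : ℝ) ^ j ≤ 1 := pow_le_one₀ (by norm_num) (by norm_num)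
    gcongr
    exact this.trans (mul_le_of_le_one_left (norm_nonneg _) h1)
  induction k with
  | zero =>
    simp only [Function.iterate_zero, id] at hk
    simp only [commutatorElement_def, map_mul, hk, mul_one]
    rw [← map_mul, mul_inv_cancel, map_one, one_mul]
    calc T h⁻¹ = T h * T h⁻¹ := by rw [hk, one_mul]
      _ = 1 := by rw [← map_mul]; simp
  | succ k ih =>
    rcases k with _ | k
    · simpa using hk
    · refine ih ?_
      rw [Function.iterate_succ_apply'] at hk ⊢
      rw [Function.iterate_succ_apply'] at hk
      exact map_commutator_eq_one_of_commutator hM hM1 (hsmall k) hk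

/-- From `⁅g, h⁆` on, all linear parts are `1`, so commutation with `g` acts on translation parts as
`T g - 1`. Hence `(T g - 1) ^ k` kills `a ⁅g, h⁆` for some `k`, and power boundedness reduces `k` to
`1`. -/
theorem sub_one_apply_commutator_eq_zero (ha : ∀ g h, a (g * h) = a g + T g (a h))
    (hM : ∀ g, ‖T g‖ ≤ M) (hM1 : 1 ≤ M) (hfin : ∀ R : ℝ, {g | ‖a g‖ ≤ R}.Finite) {g h : Γ}
    (hg : 8 * M ^ 3 * ‖T g - 1‖ ≤ 1) (hh : 8 * M ^ 3 * ‖T h - 1‖ ≤ 1) :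
    (T g - 1) ((T g - 1) (a h) - (T h - 1) (a g)) = 0 := by
  have hone := map_commutator_eq_one_of_small ha hM hM1 hfin hg hh
  have hs : 8 * M ^ 3 * ‖T ⁅g, h⁆ - 1‖ ≤ 1 := by rw [hone]; simp
  obtain ⟨k, -, hk⟩ := exists_iterate_commutator_trivial ha hM hM1 hfin hg hs
  have hit (j : ℕ) : T ((fun x => ⁅g, x⁆)^[j] ⁅g, h⁆) = 1 ∧
      a ((fun x => ⁅g, x⁆)^[j] ⁅g, h⁆) = ((T g - 1) ^ j) (a ⁅g, h⁆) := by
    induction j with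
    | zero => simpa using hone
    | succ j ih =>
      rw [Function.iterate_succ_apply']
      have h1 : T ⁅g, (fun x => ⁅g, x⁆)^[j] ⁅g, h⁆⁆ = 1 := by
        refine map_commutator_eq_one_of_small ha hM hM1 hfin hg ?_
        rw [ih.1]; simp
      refine ⟨h1, ?_⟩
      rw [cocycle_commutator ha, h1, ih.1, ih.2, pow_succ', mul_apply_eq_comp]
      simp
  rw [(hit k).2] at hk
  have := sub_one_apply_eq_zero_of_pow (A := T g) (M := M)
    (fun n => by rw [← map_pow]; exact hM _) hk
  rwa [cocycle_commutator ha, hone, sub_self, zero_apply,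
    zero_apply, sub_zero, sub_zero] at this

/-- Two elements of a discrete group of affine maps with bounded linear parts commute, as affine
maps, if their linear parts are close to the identity. -/
theorem commute_of_small [FiniteDimensional ℝ V] (ha : ∀ g h, a (g * h) = a g + T g (a h))
    (hM : ∀ g, ‖T g‖ ≤ M) (hM1 : 1 ≤ M) (hfin : ∀ R : ℝ, {g | ‖a g‖ ≤ R}.Finite) {g h : Γ}
    (hg : 8 * M ^ 3 * ‖T g - 1‖ ≤ 1) (hh : 8 * M ^ 3 * ‖T h - 1‖ ≤ 1) :
    Commute (T g) (T h) ∧ (T g - 1) (a h) = (T h - 1) (a g) := by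
  have hc : Commute (T g) (T h) := by
    have e := congrArg T (show ⁅g, h⁆ * (h * g) = g * h by
      simp [commutatorElement_def, mul_assoc])
    rw [map_mul, map_commutator_eq_one_of_small ha hM hM1 hfin hg hh, one_mul, map_mul,
      map_mul] at e
    exact e.symm
  exact ⟨hc, sub_one_apply_eq_of_fixed (fun n => by rw [← map_pow]; exact hM _)
    (fun n => by rw [← map_pow]; exact hM _) hc
    (sub_one_apply_commutator_eq_zero ha hM hM1 hfin hg hh)
    (sub_one_apply_commutator_eq_zero ha hM hM1 hfin hh hg)⟩

end Cocycle

/-! ### From commuting affine maps to a subspace. -/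

/-- For commuting power bounded operators there is an operator `S` onto common fixed vectors that
is congruent to `1` modulo the left ideal generated by the `A - 1`. -/
theorem exists_common_fixed_projection {V : Type*} [NormedAddCommGroup V] [NormedSpace ℝ V]
    [FiniteDimensional ℝ V] {M : ℝ} {𝒯 : Set (V →L[ℝ] V)}
    (hcomm : ∀ A ∈ 𝒯, ∀ B ∈ 𝒯, Commute A B) (hM : ∀ A ∈ 𝒯, ∀ n : ℕ, ‖A ^ n‖ ≤ M) :
    ∃ S : V →L[ℝ] V, S - 1 ∈ Ideal.span ((fun A => A - 1) '' 𝒯) ∧ (∀ A ∈ 𝒯, Commute A S) ∧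
      ∀ A ∈ 𝒯, (A - 1) * S = 0 := by
  -- Induction on the rank of `S`: if some `A` moves a vector of the range, replacing `S` by `P * S`
  -- lowers the rank, since `P` kills the nonzero vector `(A - 1) (S y)` of that range.
  suffices key : ∀ (n : ℕ) (S : V →L[ℝ] V), Module.finrank ℝ S.toLinearMap.range = n →
      S - 1 ∈ Ideal.span ((fun A => A - 1) '' 𝒯) → (∀ A ∈ 𝒯, Commute A S) →
      ∃ S : V →L[ℝ] V, S - 1 ∈ Ideal.span ((fun A => A - 1) '' 𝒯) ∧ (∀ A ∈ 𝒯, Commute A S) ∧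
        ∀ A ∈ 𝒯, (A - 1) * S = 0 from
    key _ 1 rfl (by simp) fun A _ => Commute.one_right A
  intro n
  induction n using Nat.strong_induction_on with
  | _ n ih =>
  intro S hn hS hcS
  by_cases h : ∀ A ∈ 𝒯, (A - 1) * S = 0
  · exact ⟨S, hS, hcS, h⟩
  push Not at h
  obtain ⟨A, hA, hAS⟩ := h
  obtain ⟨P, R, hP, hR, hcP⟩ := exists_fixed_projection (hM A hA)
  refine ih _ ?_ (P * S) rfl ?_ fun B hB => ?_
  · obtain ⟨y, hy⟩ : ∃ y, ((A - 1) * S) y ≠ 0 := by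
      by_contra! hall
      exact hAS (ContinuousLinearMap.ext hall)
    have hrange : ((P * S : V →L[ℝ] V)).toLinearMap.range
        = (P.toLinearMap.domRestrict S.toLinearMap.range).range := by
      ext x; simp
    have hcAS : (A - 1) * S = S * (A - 1) :=
      ((hcS A hA).sub_left (Commute.one_left S)).eq
    have hker : (P.toLinearMap.domRestrict S.toLinearMap.range).ker ≠ ⊥ := by
      intro hbot
      have hmem : ((A - 1) * S) y ∈ S.toLinearMap.range := by
        rw [hcAS]; exact ⟨(A - 1) y, rfl⟩
      have : (⟨_, hmem⟩ : S.toLinearMap.range) ∈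
          (P.toLinearMap.domRestrict S.toLinearMap.range).ker :=
        DFunLike.congr_fun hP (S y)
      rw [hbot, Submodule.mem_bot] at this
      exact hy (congrArg Subtype.val this)
    have := (P.toLinearMap.domRestrict S.toLinearMap.range).finrank_range_add_finrank_ker
    have hpos := Submodule.one_le_finrank_iff.2 hker
    rw [← hn, hrange]
    omega
  · have e : P * S - 1 = P * (S - 1) + R * (A - 1) := by
      rw [mul_sub, mul_one]; nth_rewrite 3 [hR]; abel
    rw [e]
    exact Ideal.add_mem _ (Ideal.mul_mem_left _ _ hS)
      (Ideal.mul_mem_left _ _ (Ideal.subset_span ⟨A, hA, rfl⟩))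
  · exact (hcP B (hcomm A hA B hB)).symm.mul_right (hcS B hB)

/-- An additive subgroup is coarsely dense in its real span. -/
theorem AddSubgroup.exists_norm_sub_le_of_mem_span {V : Type*} [NormedAddCommGroup V]
    [NormedSpace ℝ V] [FiniteDimensional ℝ V] (Λ : AddSubgroup V) :
    ∃ C : ℝ, ∀ w ∈ Submodule.span ℝ (Λ : Set V), ∃ l ∈ Λ, ‖l - w‖ ≤ C := by
  obtain ⟨b, hb, hspan, hli⟩ := exists_linearIndependent ℝ (Λ : Set V)
  have : Fintype b := hli.setFinite.fintype
  refine ⟨∑ i : b, ‖(i : V)‖, fun w hw => ?_⟩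
  rw [← hspan, ← Subtype.range_coe (s := b)] at hw
  obtain ⟨c, rfl⟩ := (Submodule.mem_span_range_iff_exists_fun ℝ).1 hw
  refine ⟨∑ i : b, ⌊c i⌋ • (i : V), sum_mem fun i _ => zsmul_mem (hb i.2) _, ?_⟩
  rw [← Finset.sum_sub_distrib]
  refine norm_sum_le_of_le _ fun i _ => ?_
  rw [← Int.cast_smul_eq_zsmul ℝ, ← sub_smul, norm_smul]
  refine mul_le_of_le_one_left (norm_nonneg _) ?_
  rw [Real.norm_eq_abs, abs_sub_comm, abs_of_nonneg (sub_nonneg.2 (Int.floor_le _))]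
  exact (Int.fract_lt_one (c i)).le

section Cocycle

variable {Γ V : Type*} [Group Γ] [NormedAddCommGroup V] [NormedSpace ℝ V]
  {T : Γ →* (V →L[ℝ] V)} {a : Γ → V} {M : ℝ}

/-- The affine action on `V` with linear part `T` and translation part `a`. -/
def affineActionHom (T : Γ →* (V →L[ℝ] V)) (a : Γ → V)
    (ha : ∀ g h, a (g * h) = a g + T g (a h)) : Γ →* Equiv.Perm V :=
  MonoidHom.toHomPerm
    { toFun := fun g v => a g + T g v
      map_one' := by
        have := ha 1 1
        simp only [mul_one, map_one, one_apply_eq_self, left_eq_add] at this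
        funext v; simp [this]; rfl
      map_mul' := fun g h => by
        funext v
        change a (g * h) + T (g * h) v = a g + T g (a h + T h v)
        rw [ha, map_mul, mul_apply_eq_comp, map_add, add_assoc] }

/-- This turns the pair of conditions into commutation in a group, so that it passes from generators
to the subgroup they generate. -/
theorem affineActionHom_commute_iff (ha : ∀ g h, a (g * h) = a g + T g (a h)) {g h : Γ} :
    Commute (affineActionHom T a ha g) (affineActionHom T a ha h) ↔
      Commute (T g) (T h) ∧ (T g - 1) (a h) = (T h - 1) (a g) := by
  have hiff : Commute (affineActionHom T a ha g) (affineActionHom T a ha h) ↔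
      ∀ v, a g + T g (a h + T h v) = a h + T h (a g + T g v) := Equiv.ext_iff
  rw [hiff]
  simp only [sub_apply, one_apply_eq_self, map_add]
  constructor
  · intro H
    have h0 := H 0
    simp only [map_zero, add_zero] at h0
    refine ⟨ContinuousLinearMap.ext fun v => ?_, ?_⟩
    · have := H v
      rw [← add_assoc, ← add_assoc, h0] at this
      exact add_left_cancel this
    · rw [sub_eq_sub_iff_add_eq_add, add_comm, h0, add_comm]
  · rintro ⟨h1, h2⟩ v
    have h3 : T g (T h v) = T h (T g v) := DFunLike.congr_fun h1.eq v
    rw [sub_eq_sub_iff_add_eq_add] at h2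
    rw [h3, ← add_assoc, ← add_assoc, add_comm (a g), h2, add_comm (a h)]

/-- A discrete group of affine maps with commuting elements and bounded linear parts has an orbit
at bounded distance from a linear subspace. -/
theorem exists_submodule_of_pairwise_commute [FiniteDimensional ℝ V]
    (ha : ∀ g h, a (g * h) = a g + T g (a h)) (hM : ∀ g, ‖T g‖ ≤ M)
    (hcomm : ∀ g h, Commute (T g) (T h) ∧ (T g - 1) (a h) = (T h - 1) (a g)) :
    ∃ (W : Submodule ℝ V) (C : ℝ), (∀ g, ∃ w ∈ W, ‖a g - w‖ ≤ C) ∧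
      ∀ w ∈ W, ∃ g, ‖a g - w‖ ≤ C := by
  obtain ⟨S, hS, hcS, hfix⟩ := exists_common_fixed_projection (𝒯 := Set.range T) (M := M)
    (by rintro _ ⟨g, rfl⟩ _ ⟨h, rfl⟩; exact (hcomm g h).1)
    (by rintro _ ⟨g, rfl⟩ n; rw [← map_pow]; exact hM _)
  -- For fixed `h`, `(T h - 1) (a g) = (T g - 1) (a h)` is bounded in `g`. Operators bounded along
  -- `a` form a left ideal, which therefore contains `S - 1`.
  obtain ⟨C, hC⟩ : ∃ C : ℝ, ∀ g, ‖(S - 1) (a g)‖ ≤ C := by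
    refine Submodule.span_induction (p := fun X _ => ∃ C : ℝ, ∀ g, ‖X (a g)‖ ≤ C)
      ?_ ?_ ?_ ?_ hS
    · rintro _ ⟨_, ⟨h, rfl⟩, rfl⟩
      refine ⟨(M + 1) * ‖a h‖, fun g => ?_⟩
      change ‖(T h - 1) (a g)‖ ≤ _
      rw [(hcomm h g).2, sub_apply, one_apply_eq_self, add_mul, one_mul]
      exact (norm_sub_le _ _).trans (by gcongr; exact (T g).le_of_opNorm_le (hM g) _)
    · exact ⟨0, fun g => by simp⟩
    · rintro X Y - - ⟨C, hC⟩ ⟨D, hD⟩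
      exact ⟨C + D, fun g => (norm_add_le _ _).trans (add_le_add (hC g) (hD g))⟩
    · rintro Y X - ⟨C, hC⟩
      exact ⟨‖Y‖ * C, fun g => Y.le_opNorm_of_le (hC g)⟩
  have hST (g : Γ) (v : V) : S (T g v) = S v := by
    have h1 : (T g - 1) (S v) = 0 := DFunLike.congr_fun (hfix _ ⟨g, rfl⟩) v
    have h2 : T g (S v) = S (T g v) := DFunLike.congr_fun (hcS _ ⟨g, rfl⟩).eq v
    rw [← h2]
    simpa [sub_eq_zero] using h1
  have hmul (g h : Γ) : S (a (g * h)) = S (a g) + S (a h) := by rw [ha, map_add, hST]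
  have hone : S (a 1) = 0 := by simpa using hmul 1 1
  let Λ : AddSubgroup V :=
    { carrier := Set.range fun g => S (a g)
      zero_mem' := ⟨1, hone⟩
      add_mem' := by rintro _ _ ⟨g, rfl⟩ ⟨h, rfl⟩; exact ⟨g * h, hmul g h⟩
      neg_mem' := by
        rintro _ ⟨g, rfl⟩
        refine ⟨g⁻¹, eq_neg_of_add_eq_zero_left ?_⟩
        rw [← hmul, inv_mul_cancel, hone] }
  obtain ⟨D, hD⟩ := Λ.exists_norm_sub_le_of_mem_span
  have hC' (g : Γ) : ‖a g - S (a g)‖ ≤ C := by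
    rw [norm_sub_rev]; simpa using hC g
  have hD0 : 0 ≤ D := by
    obtain ⟨l, -, hl⟩ := hD 0 (zero_mem _)
    exact (norm_nonneg _).trans hl
  have hC0 : 0 ≤ C := (norm_nonneg _).trans (hC 1)
  refine ⟨Submodule.span ℝ Λ, C + D, fun g => ⟨S (a g), Submodule.subset_span ⟨g, rfl⟩, ?_⟩,
    fun w hw => ?_⟩
  · linarith [hC' g]
  · obtain ⟨_, ⟨g, rfl⟩, hg⟩ := hD w hw
    refine ⟨g, ?_⟩
    calc ‖a g - w‖ = ‖(a g - S (a g)) + (S (a g) - w)‖ := by congr 1; abel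
      _ ≤ C + D := (norm_add_le _ _).trans (add_le_add (hC' g) hg)

/-- A discrete group of affine maps of a finite-dimensional space with bounded linear parts has an
orbit at bounded distance from a linear subspace. -/
theorem exists_submodule_of_discrete [FiniteDimensional ℝ V]
    (ha : ∀ g h, a (g * h) = a g + T g (a h)) (hM : ∀ g, ‖T g‖ ≤ M)
    (hfin : ∀ R : ℝ, {g | ‖a g‖ ≤ R}.Finite) :
    ∃ (W : Submodule ℝ V) (C : ℝ), (∀ g, ∃ w ∈ W, ‖a g - w‖ ≤ C) ∧
      ∀ w ∈ W, ∃ g, ‖a g - w‖ ≤ C := by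
  wlog hM1 : 1 ≤ M generalizing M
  · exact this (M := 1) (fun g => (hM g).trans (not_le.1 hM1).le) le_rfl
  have hMpos : 0 < M := by linarith
  set small : Set Γ := {g | 8 * M ^ 3 * ‖T g - 1‖ ≤ 1}
  set Γ₀ := Subgroup.closure small
  have hcomm (g h : Γ₀) : Commute (T g) (T h) ∧ (T g - 1) (a h) = (T h - 1) (a g) := by
    rw [← affineActionHom_commute_iff ha]
    refine Subgroup.closure_induction₂
      (p := fun x y _ _ => Commute (affineActionHom T a ha x) (affineActionHom T a ha y))
      ?_ ?_ ?_ ?_ ?_ ?_ ?_ g.2 h.2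
    · intro x y hx hy
      rw [affineActionHom_commute_iff]
      exact commute_of_small ha hM hM1 hfin hx hy
    · intro x _; rw [map_one]; exact Commute.one_left _
    · intro x _; rw [map_one]; exact Commute.one_right _
    · intro x y z _ _ _ h1 h2; rw [map_mul]; exact h1.mul_left h2
    · intro x y z _ _ _ h1 h2; rw [map_mul]; exact h1.mul_right h2
    · intro x y _ _ h1; rw [map_inv]; exact h1.inv_left
    · intro x y _ _ h1; rw [map_inv]; exact h1.inv_right
  obtain ⟨W, C, hW1, hW2⟩ := exists_submodule_of_pairwise_commute (T := T.comp Γ₀.subtype)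
    (a := fun g : Γ₀ => a g) (fun g h => ha g h) (fun g => hM g) hcomm
  have htb : TotallyBounded (Set.range T) := by
    refine (Metric.isBounded_closedBall (x := (0 : V →L[ℝ] V)) (r := M)).subset ?_
      |>.isCompact_closure.totallyBounded.subset subset_closure
    rintro _ ⟨g, rfl⟩
    simpa using hM g
  -- Each `g` is a small element times one of finitely many representatives `r x`. The radius has `M
  -- ^ 4` because multiplying by `T (r x)⁻¹` costs one factor `M`.
  obtain ⟨t, htsub, htfin, htcov⟩ :=
    Metric.finite_approx_of_totallyBounded htb (1 / (8 * M ^ 4)) (by positivity)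
  choose! r hr using fun x (hx : x ∈ t) => htsub hx
  obtain ⟨D, hD⟩ := (htfin.image fun x => ‖a (r x)‖).bddAbove
  refine ⟨W, C + M * D, fun g => ?_, fun w hw => ?_⟩
  · obtain ⟨x, hx, hgx⟩ : ∃ x ∈ t, ‖T g - x‖ < 1 / (8 * M ^ 4) := by
      simpa [dist_eq_norm] using htcov ⟨g, rfl⟩
    have hs : g * (r x)⁻¹ ∈ small := by
      have e : T (g * (r x)⁻¹) - 1 = (T g - x) * T (r x)⁻¹ := by
        have h1 : T (r x) * T (r x)⁻¹ = 1 := by rw [← map_mul]; simp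
        rw [sub_mul, map_mul, ← h1, hr x hx]
      have h2 : ‖T (g * (r x)⁻¹) - 1‖ ≤ 1 / (8 * M ^ 4) * M := by
        rw [e]
        exact (norm_mul_le _ _).trans (by gcongr; exact hM _)
      calc 8 * M ^ 3 * ‖T (g * (r x)⁻¹) - 1‖ ≤ 8 * M ^ 3 * (1 / (8 * M ^ 4) * M) := by gcongr
        _ = 1 := by field_simp
    obtain ⟨w, hw, hgw⟩ := hW1 ⟨_, Subgroup.subset_closure hs⟩
    refine ⟨w, hw, ?_⟩
    have e : a g = a (g * (r x)⁻¹) + T (g * (r x)⁻¹) (a (r x)) := by rw [← ha]; simp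
    calc ‖a g - w‖ = ‖(a (g * (r x)⁻¹) - w) + T (g * (r x)⁻¹) (a (r x))‖ := by
          rw [e]; congr 1; abel
      _ ≤ C + M * D := by
        refine (norm_add_le _ _).trans (add_le_add hgw ?_)
        exact ((T _).le_of_opNorm_le (hM _) _).trans (by gcongr; exact hD ⟨x, hx, rfl⟩)
  · obtain ⟨g, hg⟩ := hW2 w hw
    have hD0 : 0 ≤ D := by
      obtain ⟨x, hx, -⟩ : ∃ x ∈ t, ‖T 1 - x‖ < 1 / (8 * M ^ 4) := by
        simpa [dist_eq_norm] using htcov ⟨1, rfl⟩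
      exact (norm_nonneg _).trans (hD ⟨x, hx, rfl⟩)
    exact ⟨g, hg.trans (le_add_of_nonneg_right (by positivity))⟩

end Cocycle

/-! ### Compactness in the semidirect product and conclusion. -/

/-- A discrete subgroup of a topological group meets every compact set in a finite set. -/
theorem Subgroup.finite_inter_of_isCompact {G : Type*} [Group G] [TopologicalSpace G]
    [IsTopologicalGroup G] (Γ : Subgroup G) [DiscreteTopology Γ] {C : Set G} (hC : IsCompact C) :
    (C ∩ Γ).Finite := by
  obtain ⟨U, hU, hUΓ⟩ : ∃ U ∈ nhds (1 : G), ∀ x ∈ U, x ∈ Γ → x = 1 := by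
    have h : ({1} : Set Γ) ∈ nhds (1 : Γ) := by simp
    obtain ⟨U, hU, hsub⟩ := mem_nhds_subtype _ _ _ |>.1 h
    exact ⟨U, hU, fun x hx hxΓ => congrArg Subtype.val (hsub (show (⟨x, hxΓ⟩ : Γ) ∈ _ from hx))⟩
  -- Each translate `N * x` contains at most one element of `Γ`, and finitely many translates cover
  -- `C`. No separation axiom is needed.
  obtain ⟨N, hN, hdiv⟩ := exists_nhds_split_inv hU
  obtain ⟨t, -, ht⟩ := hC.elim_nhds_subcover (fun x => (· * x⁻¹) ⁻¹' N) fun x _ =>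
    (continuous_mul_const x⁻¹).continuousAt.preimage_mem_nhds (by simpa using hN)
  refine (t.finite_toSet.biUnion (t := fun x => ((· * x⁻¹) ⁻¹' N) ∩ Γ) fun x _ => ?_).subset ?_
  · refine Set.Subsingleton.finite fun g hg h hh => ?_
    have := hUΓ _ (hdiv _ hg.1 _ hh.1) (by simpa using Γ.div_mem hg.2 hh.2)
    simpa [div_eq_one] using this
  · rintro g ⟨hg, hgΓ⟩
    obtain ⟨x, hx, hgx⟩ := Set.mem_iUnion₂.1 (ht hg)
    exact Set.mem_iUnion₂.2 ⟨x, hx, hgx, hgΓ⟩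

namespace Representation

variable {K V : Type*} [Group K] [NormedAddCommGroup V] [NormedSpace ℝ V]
  (τ : Representation ℝ K V)

theorem left_mul_eq (x y : τ.SemidirectGroup) :
    (x * y).left.toAdd = x.left.toAdd + τ x.right y.left.toAdd := rfl

variable [FiniteDimensional ℝ V]

/-- The linear part of an element of `K ⋉_τ V`, as a continuous linear map. -/
noncomputable def linearPart : τ.SemidirectGroup →* (V →L[ℝ] V) :=
  ((Module.End.toContinuousLinearMap (𝕜 := ℝ) V).toMulEquiv.toMonoidHom.comp τ).comp
    SemidirectProduct.rightHom

theorem linearPart_apply (x : τ.SemidirectGroup) (v : V) : τ.linearPart x v = τ x.right v := rfl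

variable [TopologicalSpace K] [CompactSpace K]

theorem isCompact_setOf_norm_left_le (R : ℝ) :
    IsCompact {x : τ.SemidirectGroup | ‖x.left.toAdd‖ ≤ R} := by
  have hi : Topology.IsInducing
      (fun x : τ.SemidirectGroup => ((x.left, x.right) : Multiplicative V × K)) := ⟨rfl⟩
  rw [hi.isCompact_iff]
  have e : (fun x : τ.SemidirectGroup => ((x.left, x.right) : Multiplicative V × K)) ''
      {x | ‖x.left.toAdd‖ ≤ R} =
      (Multiplicative.ofAdd '' Metric.closedBall (0 : V) R) ×ˢ Set.univ := by
    ext ⟨v, k⟩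
    constructor
    · rintro ⟨x, hx, hxe⟩
      obtain ⟨rfl, rfl⟩ := Prod.mk.inj hxe
      exact ⟨⟨x.left.toAdd, by simpa using hx, rfl⟩, Set.mem_univ _⟩
    · rintro ⟨⟨w, hw, rfl⟩, -⟩
      exact ⟨⟨Multiplicative.ofAdd w, k⟩, by simpa using hw, rfl⟩
  rw [e]
  exact ((isCompact_closedBall 0 R).image continuous_ofAdd).prod isCompact_univ

/-- Orbits of the compact group `K` are compact, so the operators are pointwise bounded and the
uniform boundedness principle applies. -/
theorem exists_norm_linearPart_le (hτ : Continuous fun p : K × V => τ p.1 p.2) :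
    ∃ M : ℝ, ∀ x, ‖τ.linearPart x‖ ≤ M := by
  have : CompleteSpace V := FiniteDimensional.complete ℝ V
  refine banach_steinhaus fun v => ?_
  have hc : Continuous fun k : K => τ k v := hτ.comp (Continuous.prodMk_left v)
  obtain ⟨C, hC⟩ := (isCompact_range hc).isBounded.exists_norm_le
  exact ⟨C, fun x => hC _ ⟨x.right, rfl⟩⟩

end Representation

theorem mainTheorem12 {K V : Type*} [Group K] [TopologicalSpace K] [IsTopologicalGroup K]
    [CompactSpace K] [NormedAddCommGroup V] [NormedSpace ℝ V] [FiniteDimensional ℝ V]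
    (τ : Representation ℝ K V) (hτ : Continuous fun p : K × V => τ p.1 p.2)
    (Γ : Subgroup τ.SemidirectGroup) (hΓ : DiscreteTopology Γ) :
    ∃ W : Submodule ℝ V,
      StronglySimilar (Γ : Set τ.SemidirectGroup) (τ.translation '' (W : Set V)) := by
  have := τ.isTopologicalGroup_semidirectGroup hτ
  obtain ⟨M, hM⟩ := τ.exists_norm_linearPart_le hτ
  have hM0 : 0 ≤ M := (norm_nonneg _).trans (hM 1)
  obtain ⟨W, C, hW1, hW2⟩ := exists_submodule_of_discrete (T := τ.linearPart.comp Γ.subtype)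
    (a := fun g : Γ => (g : τ.SemidirectGroup).left.toAdd) (M := M)
    (fun g h => τ.left_mul_eq g h) (fun g => hM g) fun R =>
      ((Γ.finite_inter_of_isCompact (τ.isCompact_setOf_norm_left_le R)).preimage
        Subtype.val_injective.injOn).subset fun g hg => ⟨hg, g.2⟩
  -- The vector part of `w⁻¹ * g` is `a g - w`, of norm at most `C`; that of `g⁻¹ * w` is `T g⁻¹ (w
  -- - a g)`, of norm at most `M * C`.
  refine ⟨W, 1, {x | ‖x.left.toAdd‖ ≤ max C (M * C)}, τ.isCompact_setOf_norm_left_le _, ?_, ?_⟩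
  · intro g hg
    obtain ⟨w, hw, hgw⟩ := hW1 ⟨g, hg⟩
    refine ⟨τ.translation w, ⟨1, rfl, _, ⟨w, hw, rfl⟩, one_mul _⟩, (τ.translation w)⁻¹ * g, ?_,
      mul_inv_cancel_left _ _⟩
    have e : ((τ.translation w)⁻¹ * g).left.toAdd = g.left.toAdd - w := by
      rw [Representation.translation, ← map_inv, τ.left_mul_eq]
      simp [← sub_eq_neg_add]
    rw [Set.mem_ofPred_eq, e]
    exact hgw.trans (le_max_left _ _)
  · rintro _ ⟨w, hw, rfl⟩
    obtain ⟨g, hg⟩ := hW2 w hw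
    refine ⟨(g : τ.SemidirectGroup), ⟨1, rfl, _, g.2, one_mul _⟩,
      (g : τ.SemidirectGroup)⁻¹ * τ.translation w, ?_, mul_inv_cancel_left _ _⟩
    have e : ((g : τ.SemidirectGroup)⁻¹ * τ.translation w).left.toAdd
        = τ.linearPart (g : τ.SemidirectGroup)⁻¹ (w - (g : τ.SemidirectGroup).left.toAdd) := by
      have h := τ.left_mul_eq (g : τ.SemidirectGroup)⁻¹ g
      rw [inv_mul_cancel, SemidirectProduct.one_left, toAdd_one] at h
      rw [τ.left_mul_eq, map_sub, τ.linearPart_apply, τ.linearPart_apply,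
        eq_neg_of_add_eq_zero_left h.symm, Representation.translation, SemidirectProduct.left_inl,
        toAdd_ofAdd]
      abel
    rw [Set.mem_ofPred_eq, e]
    refine le_trans ?_ (le_max_right _ _)
    exact ContinuousLinearMap.le_of_opNorm_le_of_le _ (hM _) (by rwa [norm_sub_rev])
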